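/- Let $\mathcal H_A,\mathcal H_B,\mathcal H_C$ be finite-dimensional complex Hilbert spaces and let $\rho_{ABC}$ be a quantum state (a positive semidefinite operator of trace one, not necessarily invertible) on $\mathcal H_A\otimes\mathcal H_B\otimes\mathcal H_C$, with reduced states $\rho_{AB}=\mathrm{Tr}_C\,\rho_{ABC}$ and $\rho_{BC}=\mathrm{Tr}_A\,\rho_{ABC}$. Let $S(\rho)=-\mathrm{Tr}(\rho\log\rho)$ be the von Neumann entropy (natural logarithm, $0\log 0=0$), $\|X\|_1=\mathrm{Tr}\sqrt{X^\dagger X}$ and $\|X\|_2=(\mathrm{Tr}\,X^\dagger X)^{1/2}$. Put $$\sigma:=\exp(\log\rho_{AB}+\log\rho_{BC}),$$ where $\log\rho_{AB}$ stands for $(\log\rho_{AB})\otimes 1_C$ and $\log\rho_{BC}$ for $1_A\otimes\log\rho_{BC}$. If $\rho_{AB}$ or $\rho_{BC}$ is singular, $\sigma$ is understood with the usual convention $\log 0=-\infty$, $\exp(-\infty)=0$: the logarithms are taken on the supports, and $\sigma=P\exp\bigl(P(\log\rho_{AB}+\log\rho_{BC})P\bigr)P$, where $P$ is the orthogonal projection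 onto $\operatorname{supp}(\rho_{AB}\otimes 1_C)\cap\operatorname{supp}(1_A\otimes\rho_{BC})$. Then $\sigma$ is positive semidefinite and subnormalized, i.e. $\mathrm{Tr}\,\sigma\le 1$; moreover $\mathrm{Tr}(\sqrt{\rho_{ABC}}\sqrt{\sigma})>0$, and $$S(\rho_{AB})+S(\rho_{BC})-S(\rho_{ABC})\;\ge\;-2\log\mathrm{Tr}\bigl(\sqrt{\rho_{ABC}}\sqrt{\sigma}\bigr)\;\ge\;\bigl\|\sqrt{\rho_{ABC}}-\sqrt{\sigma}\bigr\|_2^2\;\ge\;\tfrac14\,\bigl\|\rho_{ABC}-\sigma\bigr\|_1^2 .$$ -/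

import Mathlib

open scoped Kronecker ComplexOrder

noncomputable section

namespace Tripartite

/-- A quantum state on `ℂⁿ`: a positive semidefinite matrix of trace one. -/
def IsState {n : Type*} [Fintype n] (ρ : Matrix n n ℂ) : Prop :=
  ρ.PosSemidef ∧ ρ.trace = 1

/-- `log A` for a Hermitian matrix, through its spectral decomposition. Since `Real.log 0 = 0`, for
`A` positive semidefinite this is the logarithm of `A` on the support of `A`, extended by zero. -/
def logM {n : Type*} [Fintype n] [DecidableEq n] (A : Matrix n n ℂ) : Matrix n n ℂ :=
  cfc Real.log A

/-- The positive square root of a positive semidefinite matrix. -/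
def sqrtM {n : Type*} [Fintype n] [DecidableEq n] (A : Matrix n n ℂ) : Matrix n n ℂ :=
  cfc Real.sqrt A

/-- The von Neumann entropy `S(ρ) = - Tr (ρ log ρ)`, with `0 log 0 = 0` and natural logarithm. -/
def entropy {n : Type*} [Fintype n] [DecidableEq n] (ρ : Matrix n n ℂ) : ℝ :=
  -(ρ * logM ρ).trace.re

/-- The trace norm `‖X‖₁ = Tr |X|`, where `|X| = √(X† X)`. -/
def traceNorm {n : Type*} [Fintype n] [DecidableEq n] (X : Matrix n n ℂ) : ℝ :=
  (sqrtM (X.conjTranspose * X)).trace.re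

/-- The Hilbert-Schmidt norm `‖X‖₂ = (Tr (X† X))^(1/2)`. -/
def hsNorm {n : Type*} [Fintype n] (X : Matrix n n ℂ) : ℝ :=
  Real.sqrt (X.conjTranspose * X).trace.re

section systems

variable {a b c : Type*}

/-- The reduced matrix `ρ_AB = Tr_C ρ_ABC`. -/
def margAB [Fintype c] (ρ : Matrix (a × b × c) (a × b × c) ℂ) : Matrix (a × b) (a × b) ℂ :=
  fun p q => ∑ k, ρ (p.1, p.2, k) (q.1, q.2, k)

/-- The reduced matrix `ρ_BC = Tr_A ρ_ABC`. -/
def margBC [Fintype a] (ρ : Matrix (a × b × c) (a × b × c) ℂ) : Matrix (b × c) (b × c) ℂ :=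
  fun p q => ∑ i, ρ (i, p) (i, q)

/-- `X ↦ X ⊗ 1_C`, from operators on `AB` to operators on `ABC`. -/
def tensorIdC [DecidableEq c] (X : Matrix (a × b) (a × b) ℂ) :
    Matrix (a × b × c) (a × b × c) ℂ :=
  (X ⊗ₖ (1 : Matrix c c ℂ)).reindex (Equiv.prodAssoc a b c) (Equiv.prodAssoc a b c)

/-- `Y ↦ 1_A ⊗ Y`, from operators on `BC` to operators on `ABC`. -/
def idTensorA [DecidableEq a] (Y : Matrix (b × c) (b × c) ℂ) :
    Matrix (a × b × c) (a × b × c) ℂ :=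
  (1 : Matrix a a ℂ) ⊗ₖ Y

end systems

/-- The orthogonal projection onto `supp X ∩ supp Y`, where the support of a Hermitian matrix
is its range. -/
def commonSupport {n : Type*} [Fintype n] [DecidableEq n] (X Y : Matrix n n ℂ) : Matrix n n ℂ :=
  (Matrix.toEuclideanCLM (n := n) (𝕜 := ℂ)).symm
    (LinearMap.range (Matrix.toEuclideanLin X) ⊓
      LinearMap.range (Matrix.toEuclideanLin Y)).starProjection

variable {a b c : Type*} [Fintype a] [DecidableEq a] [Fintype b] [DecidableEq b]
  [Fintype c] [DecidableEq c]

/-- The operator `log ρ_AB ⊗ 1_C + 1_A ⊗ log ρ_BC` (logarithms taken on the supports). -/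
def logSum (ρ : Matrix (a × b × c) (a × b × c) ℂ) : Matrix (a × b × c) (a × b × c) ℂ :=
  tensorIdC (logM (margAB ρ)) + idTensorA (logM (margBC ρ))

/-- The operator `exp (log ρ_AB + log ρ_BC)`, for marginals that may be singular. With the
convention `log 0 = -∞`, `exp (-∞) = 0`, it is the exponential of the compression of
`log ρ_AB + log ρ_BC` to the intersection of the supports of `ρ_AB ⊗ 1_C` and `1_A ⊗ ρ_BC`, and it
vanishes on the orthogonal complement of that subspace. -/
def expLogSum (ρ : Matrix (a × b × c) (a × b × c) ℂ) : Matrix (a × b × c) (a × b × c) ℂ :=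
  let P := commonSupport (tensorIdC (margAB ρ)) (idTensorA (margBC ρ))
  P * NormedSpace.exp (P * logSum ρ * P) * P

theorem range_eq_top_of_isUnit {n : Type*} [Fintype n] [DecidableEq n] {X : Matrix n n ℂ}
    (hX : IsUnit X) : LinearMap.range (Matrix.toEuclideanLin X) = ⊤ := by
  obtain ⟨Y, hY⟩ := hX.exists_right_inv
  rw [LinearMap.range_eq_top]
  intro v
  refine ⟨Matrix.toEuclideanLin Y v, ?_⟩
  simp [Matrix.toLpLin_apply, Matrix.mulVec_mulVec, hY]

/-- If both marginals are invertible, no convention is involved. -/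
theorem expLogSum_of_isUnit (ρ : Matrix (a × b × c) (a × b × c) ℂ)
    (hAB : IsUnit (margAB ρ)) (hBC : IsUnit (margBC ρ)) :
    expLogSum ρ = NormedSpace.exp (logSum ρ) := by
  have h1 : IsUnit (tensorIdC (c := c) (margAB ρ)) := by
    obtain ⟨Y, hY⟩ := hAB.exists_right_inv
    refine IsUnit.of_mul_eq_one (tensorIdC Y) ?_
    simp [tensorIdC, Matrix.submatrix_mul_equiv, ← Matrix.mul_kronecker_mul, hY]
  have h2 : IsUnit (idTensorA (a := a) (margBC ρ)) := by
    obtain ⟨Y, hY⟩ := hBC.exists_right_inv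
    refine IsUnit.of_mul_eq_one (idTensorA Y) ?_
    simp [idTensorA, ← Matrix.mul_kronecker_mul, hY]
  have hP : commonSupport (tensorIdC (margAB ρ)) (idTensorA (margBC ρ)) = 1 := by
    unfold commonSupport
    simp only [range_eq_top_of_isUnit h1, range_eq_top_of_isUnit h2, inf_top_eq]
    rw [Submodule.starProjection_top', map_one]
  simp [expLogSum, hP]

end Tripartite

end

/-! Let P be the projection in the definition of σ and G = P(log ρ_AB + log ρ_BC)P. The support of ρ
lies in the range of P, so S(ρ_AB) + S(ρ_BC) - S(ρ) = Tr ρ(log ρ - G), and √σ may be replaced by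
e^{G/2} in Tr √ρ√σ. Expanding in eigenbases of ρ and G and applying Jensen's inequality to log gives
the entropy bound and the positivity (`relEntropy_ge`), for any Hermitian G.

The crux is Tr σ ≤ 1. For invertible marginals, Golden–Thompson gives Tr σ ≤ Tr (ρ_AB ⊗ 1)(1 ⊗ ρ_BC)
= Tr ρ_B² ≤ 1. In general ε is added to both marginals: a Peierls inequality
(`trace_mul_exp_mul_le`) bounds Tr σ by the trace of the regularized exponential, Golden–Thompson
applies to that, and ε → 0.

Given Tr σ ≤ 1, the second bound is log t ≤ t - 1 and the third is of Powers–Størmer type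
(`traceNorm_sub_sq_le`). -/

namespace NormedSpace

/-! ### The Lie–Trotter formula in a Banach algebra. -/

open Filter Topology

theorem norm_exp_le_exp_norm {𝔸 : Type*} [NormedRing 𝔸] [NormOneClass 𝔸] [NormedAlgebra ℝ 𝔸]
    [CompleteSpace 𝔸] (x : 𝔸) : ‖exp x‖ ≤ Real.exp ‖x‖ := by
  have h := exp_series_hasSum_exp' (𝕂 := ℝ) x
  have h' := exp_series_hasSum_exp' (𝕂 := ℝ) (‖x‖ : ℝ)
  rw [Real.exp_eq_exp_ℝ, ← h.tsum_eq]
  refine tsum_of_norm_bounded h' fun n => ?_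
  rw [norm_smul, smul_eq_mul, Real.norm_of_nonneg (by positivity)]
  gcongr
  exact norm_pow_le x n

/-- Telescoping. The natural exponent is n - 1; since 1 ≤ M, the exponent n is also valid and avoids
a subtraction. -/
theorem norm_pow_sub_pow_le_of_le {𝔸 : Type*} [NormedRing 𝔸] [NormOneClass 𝔸] {x y : 𝔸} {M : ℝ}
    (hM : 1 ≤ M) (hx : ‖x‖ ≤ M) (hy : ‖y‖ ≤ M) (n : ℕ) :
    ‖x ^ n - y ^ n‖ ≤ n * ‖x - y‖ * M ^ n := by
  induction n with
  | zero => simp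
  | succ n ih =>
    have h0 : 0 ≤ M := by linarith
    have e : x ^ (n + 1) - y ^ (n + 1) = x ^ n * (x - y) + (x ^ n - y ^ n) * y := by
      rw [pow_succ, pow_succ]; noncomm_ring
    rw [e]
    calc _ ≤ ‖x ^ n‖ * ‖x - y‖ + ‖x ^ n - y ^ n‖ * ‖y‖ :=
          (norm_add_le _ _).trans (add_le_add (norm_mul_le _ _) (norm_mul_le _ _))
      _ ≤ M ^ n * ‖x - y‖ + (n * ‖x - y‖ * M ^ n) * M := by
          gcongr
          exact (norm_pow_le x n).trans (by gcongr)
      _ ≤ M ^ (n + 1) * ‖x - y‖ + (n * ‖x - y‖ * M ^ n) * M := by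
          gcongr
          exact n.le_succ
      _ = _ := by push_cast; ring

/-- The **Lie–Trotter product formula**. -/
theorem tendsto_exp_mul_exp_pow {𝔸 : Type*} [NormedRing 𝔸] [NormOneClass 𝔸] [NormedAlgebra ℝ 𝔸]
    [CompleteSpace 𝔸] (x y : 𝔸) :
    Tendsto (fun n : ℕ => (exp ((n : ℝ)⁻¹ • x) * exp ((n : ℝ)⁻¹ • y)) ^ n) atTop
      (𝓝 (exp (x + y))) := by
  -- The error of one step vanishes to first order at t = 0, so n errors of size ‖F(1/n)‖ still sum
  -- to o(1).
  set F : ℝ → 𝔸 := fun t => exp (t • x) * exp (t • y) - exp (t • (x + y)) with hF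
  have hF0 : F 0 = 0 := by simp [hF]
  have hd : HasDerivAt F 0 0 := by
    have h := ((hasDerivAt_exp_smul_const x (0 : ℝ)).mul
      (hasDerivAt_exp_smul_const y (0 : ℝ))).sub (hasDerivAt_exp_smul_const (x + y) (0 : ℝ))
    convert! h using 1
    simp
  have hslope : Tendsto (fun n : ℕ => (n : ℝ) * ‖F (n : ℝ)⁻¹‖) atTop (𝓝 0) := by
    have h1 := hasDerivAt_iff_tendsto_slope_zero.1 hd
    have h2 : Tendsto (fun n : ℕ => ((n : ℝ)⁻¹)) atTop (𝓝[≠] 0) := by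
      refine tendsto_nhdsWithin_iff.2 ⟨tendsto_inv_atTop_nhds_zero_nat, ?_⟩
      filter_upwards [eventually_gt_atTop 0] with n hn
      simp only [Set.mem_compl_iff, Set.mem_singleton_iff, inv_eq_zero, Nat.cast_eq_zero]
      omega
    have h3 := (h1.comp h2).norm
    simp only [norm_zero] at h3
    refine h3.congr fun n => ?_
    simp [hF0, norm_smul]
  rw [tendsto_iff_norm_sub_tendsto_zero]
  have hC := hslope.mul_const (Real.exp (‖x‖ + ‖y‖))
  rw [zero_mul] at hC
  refine squeeze_zero' (Eventually.of_forall fun n => norm_nonneg _) ?_ hC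
  filter_upwards [eventually_gt_atTop 0] with n hn
  have hn' : (n : ℝ) ≠ 0 := by positivity
  have e : exp (x + y) = exp ((n : ℝ)⁻¹ • (x + y)) ^ n := by
    let _ : NormedAlgebra ℚ 𝔸 := NormedAlgebra.restrictScalars ℚ ℝ 𝔸
    rw [← exp_nsmul, ← Nat.cast_smul_eq_nsmul ℝ, smul_smul, mul_inv_cancel₀ hn', one_smul]
  rw [e]
  -- With this M the factor M ^ n is exp (‖x‖ + ‖y‖), independent of n.
  refine (norm_pow_sub_pow_le_of_le (M := Real.exp ((n : ℝ)⁻¹ * (‖x‖ + ‖y‖))) ?_ ?_ ?_ n).trans ?_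
  · exact Real.one_le_exp (by positivity)
  · refine (norm_mul_le _ _).trans ?_
    rw [mul_add, Real.exp_add]
    gcongr
    · refine (norm_exp_le_exp_norm _).trans_eq ?_
      rw [norm_smul, Real.norm_of_nonneg (by positivity)]
    · refine (norm_exp_le_exp_norm _).trans_eq ?_
      rw [norm_smul, Real.norm_of_nonneg (by positivity)]
  · refine (norm_exp_le_exp_norm _).trans ?_
    rw [norm_smul, Real.norm_of_nonneg (by positivity)]
    gcongr
    exact norm_add_le _ _
  · rw [← Real.exp_nat_mul, mul_inv_cancel_left₀ hn']

end NormedSpace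

/-! ### Golden–Thompson. -/

namespace Matrix

variable {n : Type*} [Fintype n]

open Filter Topology

theorem tendsto_exp_mul_exp_pow [DecidableEq n] (X Y : Matrix n n ℂ) :
    Tendsto (fun k : ℕ => (NormedSpace.exp ((k : ℝ)⁻¹ • X) * NormedSpace.exp ((k : ℝ)⁻¹ • Y)) ^ k)
      atTop (𝓝 (NormedSpace.exp (X + Y))) := by
  -- The identity has operator norm one only when `n` is nonempty.
  cases isEmpty_or_nonempty n
  · simp only [Subsingleton.elim _ (0 : Matrix n n ℂ)]
    exact tendsto_const_nhds
  · let _ : NormedRing (Matrix n n ℂ) := Matrix.linftyOpNormedRing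
    let _ : NormedAlgebra ℝ (Matrix n n ℂ) := Matrix.linftyOpNormedAlgebra
    have : NormOneClass (Matrix n n ℂ) := Matrix.linfty_opNormOneClass
    exact NormedSpace.tendsto_exp_mul_exp_pow X Y

theorem trace_conjTranspose_mul_self_eq_sum (X : Matrix n n ℂ) :
    (Xᴴ * X).trace.re = ∑ i, ∑ j, ‖X i j‖ ^ 2 := by
  rw [Finset.sum_comm]
  simp [Matrix.trace, Matrix.mul_apply, ← Complex.normSq_eq_conj_mul_self, Complex.sq_norm]

/-- The Cauchy–Schwarz inequality for the Hilbert–Schmidt inner product. -/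
theorem norm_trace_mul_sq_le (X Y : Matrix n n ℂ) :
    ‖(X * Y).trace‖ ^ 2 ≤ (Xᴴ * X).trace.re * (Yᴴ * Y).trace.re := by
  rw [trace_conjTranspose_mul_self_eq_sum, trace_conjTranspose_mul_self_eq_sum,
    Finset.sum_comm (f := fun i j => ‖Y i j‖ ^ 2), ← Finset.sum_product', ← Finset.sum_product']
  refine le_trans ?_ (Finset.sum_mul_sq_le_sq_mul_sq _ _ _)
  gcongr
  simp only [Matrix.trace, Matrix.mul_apply, diag_apply]
  rw [← Finset.sum_product']
  exact (norm_sum_le _ _).trans_eq (by simp)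

theorem trace_mul_pow_comm [DecidableEq n] (A B : Matrix n n ℂ) (m : ℕ) :
    ((A * B) ^ m).trace = ((B * A) ^ m).trace := by
  cases m with
  | zero => simp
  | succ m =>
    rw [pow_succ, ← mul_assoc, Matrix.trace_mul_comm, ← mul_assoc, ← mul_pow_mul, mul_assoc,
      ← pow_succ]

theorem trace_conjTranspose_mul_self_pow_nonneg [DecidableEq n] (W : Matrix n n ℂ) (m : ℕ) :
    0 ≤ ((Wᴴ * W) ^ m).trace.re :=
  (Complex.le_def.1 ((posSemidef_conjTranspose_mul_self W).pow m).trace_nonneg).1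

/-- Iterated Cauchy–Schwarz. With Z = XY, the case (Z, Z) bounds |Tr Z^{2^(k+1)}| by Tr (Zᴴ
Z)^{2^k}; by cyclicity this is Tr (XᴴX · YYᴴ)^{2^k}, to which the induction hypothesis applies
again. -/
theorem norm_trace_mul_pow_sq_le [DecidableEq n] (k : ℕ) (X Y : Matrix n n ℂ) :
    ‖((X * Y) ^ 2 ^ k).trace‖ ^ 2 ≤
      ((Xᴴ * X) ^ 2 ^ k).trace.re * ((Yᴴ * Y) ^ 2 ^ k).trace.re := by
  induction k generalizing X Y with
  | zero => simpa using norm_trace_mul_sq_le X Y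
  | succ k ih =>
    set Z := X * Y with hZ
    have h1 : ‖(Z ^ 2 ^ (k + 1)).trace‖ ^ 2 ≤ ((Zᴴ * Z) ^ 2 ^ k).trace.re ^ 2 := by
      have := ih Z Z
      rwa [← sq Z, ← pow_mul, ← pow_succ', ← sq] at this
    have h2 : ((Zᴴ * Z) ^ 2 ^ k).trace = (((Xᴴ * X) * (Y * Yᴴ)) ^ 2 ^ k).trace := by
      have : Zᴴ * Z = Yᴴ * (Xᴴ * X * Y) := by simp [hZ, mul_assoc]
      rw [this, trace_mul_pow_comm]
      simp only [mul_assoc]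
    have h3 := ih (Xᴴ * X) (Y * Yᴴ)
    rw [← h2] at h3
    calc _ ≤ ((Zᴴ * Z) ^ 2 ^ k).trace.re ^ 2 := h1
      _ ≤ ‖((Zᴴ * Z) ^ 2 ^ k).trace‖ ^ 2 := by
          rw [sq_le_sq, abs_norm]; exact Complex.abs_re_le_norm _
      _ ≤ _ := h3
      _ = _ := by
          rw [conjTranspose_mul, conjTranspose_conjTranspose, conjTranspose_mul,
            conjTranspose_conjTranspose, ← sq, ← sq, ← pow_mul, ← pow_mul, ← pow_succ',
            trace_mul_pow_comm Y]

theorem norm_trace_pow_le [DecidableEq n] (k : ℕ) (Z : Matrix n n ℂ) :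
    ‖(Z ^ 2 ^ (k + 1)).trace‖ ≤ ((Zᴴ * Z) ^ 2 ^ k).trace.re := by
  have := norm_trace_mul_pow_sq_le k Z Z
  rw [← sq Z, ← pow_mul, ← pow_succ', ← sq] at this
  exact (pow_le_pow_iff_left₀ (norm_nonneg _) (trace_conjTranspose_mul_self_pow_nonneg Z _)
    two_ne_zero).1 this

/-- Golden's inequality: `Tr (A B)^m ≤ Tr A^m B^m` for Hermitian `A`, `B` and `m` a power of two. -/
theorem IsHermitian.trace_mul_pow_le [DecidableEq n] (k : ℕ) {A B : Matrix n n ℂ}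
    (hA : A.IsHermitian) (hB : B.IsHermitian) :
    ((A * B) ^ 2 ^ k).trace.re ≤ (A ^ 2 ^ k * B ^ 2 ^ k).trace.re := by
  induction k generalizing A B with
  | zero => simp
  | succ k ih =>
    have h := ((Complex.re_le_norm _).trans (norm_trace_pow_le k (A * B)))
    -- By cyclicity, Tr ((AB)ᴴ(AB))^{2^k} = Tr (A²B²)^{2^k}, so the induction continues with A², B².
    have e : (A * B)ᴴ * (A * B) = B * (A * A * B) := by
      rw [conjTranspose_mul, hA.eq, hB.eq]; simp only [mul_assoc]
    rw [e, trace_mul_pow_comm B, mul_assoc (A * A), ← sq, ← sq] at h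
    refine (h.trans (ih (hA.pow 2) (hB.pow 2))).trans_eq ?_
    rw [← pow_mul, ← pow_mul, ← pow_succ']

/-- The **Golden–Thompson inequality**. -/
theorem IsHermitian.trace_exp_add_le [DecidableEq n] {X Y : Matrix n n ℂ}
    (hX : X.IsHermitian) (hY : Y.IsHermitian) :
    (NormedSpace.exp (X + Y)).trace.re ≤ (NormedSpace.exp X * NormedSpace.exp Y).trace.re := by
  -- Golden's inequality is available for powers of two, so Lie–Trotter is restricted to that
  -- subsequence.
  have h := (tendsto_exp_mul_exp_pow X Y).comp
    (tendsto_pow_atTop_atTop_of_one_lt (one_lt_two (α := ℕ)))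
  have hc : Continuous fun M : Matrix n n ℂ => M.trace.re := by fun_prop
  refine le_of_tendsto ((hc.tendsto _).comp h) (Eventually.of_forall fun k => ?_)
  have hk : ((2 ^ k : ℕ) : ℝ) ≠ 0 := by positivity
  have hs : ∀ {W : Matrix n n ℂ}, W.IsHermitian →
      (NormedSpace.exp (((2 ^ k : ℕ) : ℝ)⁻¹ • W)).IsHermitian := fun {W} hW =>
    IsHermitian.exp (by rw [IsHermitian, conjTranspose_smul, hW.eq]; simp)
  have he : ∀ W : Matrix n n ℂ,
      NormedSpace.exp (((2 ^ k : ℕ) : ℝ)⁻¹ • W) ^ 2 ^ k = NormedSpace.exp W := fun W => by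
    rw [← Matrix.exp_nsmul, ← Nat.cast_smul_eq_nsmul ℝ, smul_smul, mul_inv_cancel₀ hk, one_smul]
  simpa only [he, Function.comp_apply] using IsHermitian.trace_mul_pow_le k (hs hX) (hs hY)

end Matrix

/-! ### Functional calculus and Klein's inequality. -/

namespace Matrix

variable {n : Type*} [Fintype n] [DecidableEq n]

/-- The spectrum is finite, so discontinuous functions (signs, indicators of zero, the logarithm)
are admissible in `cfc`. -/
theorem continuousOn_spectrum (f : ℝ → ℝ) (A : Matrix n n ℂ) : ContinuousOn f (spectrum ℝ A) :=
  finite_real_spectrum.continuousOn f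

theorem IsHermitian.exp_eq_cfc {A : Matrix n n ℂ} (hA : A.IsHermitian) :
    NormedSpace.exp A = cfc Real.exp A := by
  have h := Matrix.exp_units_conj (Unitary.toUnits hA.eigenvectorUnitary)
    (diagonal (RCLike.ofReal ∘ hA.eigenvalues : n → ℂ))
  rw [exp_diagonal] at h
  rw [hA.cfc_eq, IsHermitian.cfc, Unitary.conjStarAlgAut_apply]
  conv_lhs => rw [hA.spectral_theorem, Unitary.conjStarAlgAut_apply]
  refine h.trans ?_
  have e : NormedSpace.exp (RCLike.ofReal ∘ hA.eigenvalues : n → ℂ)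
      = RCLike.ofReal ∘ Real.exp ∘ hA.eigenvalues := by
    ext i
    simp [Pi.coe_exp, ← Complex.exp_eq_exp_ℂ]
  rw [e]
  rfl

/-- The weights are |⟨u_i, v_j⟩|² for the two eigenbases. As they do not depend on f and g, trace
inequalities for noncommuting A, B reduce to scalar ones on pairs of eigenvalues. -/
theorem IsHermitian.exists_trace_cfc_mul_cfc {A B : Matrix n n ℂ} (hA : A.IsHermitian)
    (hB : B.IsHermitian) :
    ∃ w : n → n → ℝ, (∀ i j, 0 ≤ w i j) ∧ ∀ f g : ℝ → ℝ, (cfc f A * cfc g B).trace.re =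
      ∑ i, ∑ j, f (hA.eigenvalues i) * g (hB.eigenvalues j) * w i j := by
  set U : Matrix n n ℂ := (hA.eigenvectorUnitary : Matrix n n ℂ) with hU
  set V : Matrix n n ℂ := (hB.eigenvectorUnitary : Matrix n n ℂ) with hV
  refine ⟨fun i j => Complex.normSq ((star U * V) i j), fun i j => Complex.normSq_nonneg _,
    fun f g => ?_⟩
  rw [hA.cfc_eq, hB.cfc_eq, IsHermitian.cfc, IsHermitian.cfc, Unitary.conjStarAlgAut_apply,
    Unitary.conjStarAlgAut_apply, ← hU, ← hV]
  set D := diagonal (RCLike.ofReal ∘ f ∘ hA.eigenvalues : n → ℂ) with hD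
  set E := diagonal (RCLike.ofReal ∘ g ∘ hB.eigenvalues : n → ℂ) with hE
  have e : (U * D * star U * (V * E * star V)).trace
      = (D * ((star U * V) * E * star (star U * V))).trace := by
    rw [mul_assoc, mul_assoc, Matrix.trace_mul_comm]
    simp only [star_mul, star_star, mul_assoc]
  rw [e]
  simp only [Matrix.trace, diag_apply, hD, diagonal_mul, Complex.re_sum]
  refine Finset.sum_congr rfl fun i _ => ?_
  rw [mul_apply]
  simp only [hE, mul_diagonal, star_apply, Finset.mul_sum, Complex.re_sum]
  refine Finset.sum_congr rfl fun j _ => ?_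
  rw [mul_right_comm ((star U * V) i j), RCLike.star_def, Complex.mul_conj]
  simp
  ring

/-- Klein's inequality: the tangent line bound e^x + e^x (y - x) ≤ e^y, summed over pairs of
eigenvalues. -/
theorem IsHermitian.trace_exp_add_trace_exp_mul_sub_le {X Y : Matrix n n ℂ} (hX : X.IsHermitian)
    (hY : Y.IsHermitian) :
    (NormedSpace.exp X).trace.re + (NormedSpace.exp X * (Y - X)).trace.re ≤
      (NormedSpace.exp Y).trace.re := by
  obtain ⟨w, hw, h⟩ := hX.exists_trace_cfc_mul_cfc hY
  have hX' : IsSelfAdjoint X := hX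
  have hY' : IsSelfAdjoint Y := hY
  have e1 := h Real.exp (fun _ => 1)
  have e2 := h (fun _ => 1) Real.exp
  have e3 := h Real.exp id
  have e4 := h (fun x => Real.exp x * x) (fun _ => 1)
  rw [cfc_mul _ _ X (continuousOn_spectrum _ _) (continuousOn_spectrum _ _), cfc_id' ℝ X] at e4
  simp only [cfc_const_one ℝ X, cfc_const_one ℝ Y, cfc_id ℝ Y, ← hX.exp_eq_cfc, ← hY.exp_eq_cfc,
    mul_one, one_mul] at e1 e2 e3 e4
  rw [mul_sub, trace_sub, Complex.sub_re, e1, e2, e3, e4, ← Finset.sum_sub_distrib,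
    ← Finset.sum_add_distrib]
  refine Finset.sum_le_sum fun i _ => ?_
  rw [← Finset.sum_sub_distrib, ← Finset.sum_add_distrib]
  refine Finset.sum_le_sum fun j _ => ?_
  set x := hX.eigenvalues i
  set y := hY.eigenvalues j
  have h1 : Real.exp x + Real.exp x * (y - x) ≤ Real.exp y := by
    have := Real.add_one_le_exp (y - x)
    calc _ = Real.exp x * (y - x + 1) := by ring
      _ ≤ Real.exp x * Real.exp (y - x) := by gcongr
      _ = _ := by rw [← Real.exp_add]; ring_nf
  have := mul_le_mul_of_nonneg_right h1 (hw i j)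
  simp only [id]
  linarith

theorem isHermitian_cfc (A : Matrix n n ℂ) (f : ℝ → ℝ) : (cfc f A).IsHermitian :=
  cfc_predicate f A

theorem posSemidef_cfc {A : Matrix n n ℂ} {f : ℝ → ℝ} (hf : ∀ x ∈ spectrum ℝ A, 0 ≤ f x) :
    (cfc f A).PosSemidef := by
  have e : cfc f A = (cfc (fun x => √(f x)) A)ᴴ * cfc (fun x => √(f x)) A := by
    rw [(isHermitian_cfc A _).eq, ← cfc_mul _ _ A (continuousOn_spectrum _ _)
      (continuousOn_spectrum _ _)]
    exact cfc_congr fun x hx => (Real.mul_self_sqrt (hf x hx)).symm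
  rw [e]
  exact posSemidef_conjTranspose_mul_self _

theorem PosSemidef.spectrum_nonneg {A : Matrix n n ℂ} (hA : A.PosSemidef) {x : ℝ}
    (hx : x ∈ spectrum ℝ A) : 0 ≤ x := by
  rw [hA.1.spectrum_real_eq_range_eigenvalues] at hx
  obtain ⟨i, rfl⟩ := hx
  exact hA.eigenvalues_nonneg i

theorem IsHermitian.trace_cfc {A : Matrix n n ℂ} (hA : A.IsHermitian) (f : ℝ → ℝ) :
    (cfc f A).trace.re = ∑ i, f (hA.eigenvalues i) := by
  rw [hA.cfc_eq, IsHermitian.cfc, Unitary.conjStarAlgAut_apply, trace_mul_cycle,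
    Unitary.coe_star_mul_self, one_mul]
  simp [Matrix.trace]

theorem PosSemidef.trace_mul_self_le {A : Matrix n n ℂ} (hA : A.PosSemidef) :
    (A * A).trace.re ≤ A.trace.re ^ 2 := by
  have hA' : IsSelfAdjoint A := hA.1
  have h1 := hA.1.trace_cfc (fun x => x * x)
  have h2 := hA.1.trace_cfc id
  rw [cfc_mul _ _ A (continuousOn_spectrum _ _) (continuousOn_spectrum _ _), cfc_id' ℝ A] at h1
  rw [cfc_id ℝ A] at h2
  rw [h1, h2]
  simp only [← sq, id]
  rw [sq, Finset.sum_mul]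
  refine Finset.sum_le_sum fun i hi => ?_
  rw [sq]
  exact mul_le_mul_of_nonneg_left
    (Finset.single_le_sum (fun j _ => hA.eigenvalues_nonneg j) hi) (hA.eigenvalues_nonneg i)

end Matrix

/-! ### Square roots, Powers–Størmer, and the entropy bound. -/

namespace Tripartite

open Matrix

variable {n : Type*} [Fintype n] [DecidableEq n]

theorem sqrtM_posSemidef (A : Matrix n n ℂ) : (sqrtM A).PosSemidef :=
  posSemidef_cfc fun _ _ => Real.sqrt_nonneg _

theorem sqrtM_mul_self {A : Matrix n n ℂ} (hA : A.PosSemidef) : sqrtM A * sqrtM A = A := by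
  have hA' : IsSelfAdjoint A := hA.1
  rw [sqrtM, ← cfc_mul _ _ A (continuousOn_spectrum _ _) (continuousOn_spectrum _ _)]
  conv_rhs => rw [← cfc_id ℝ A]
  exact cfc_congr fun x hx => Real.mul_self_sqrt (hA.spectrum_nonneg hx)

theorem sqrtM_mul_self_eq {R : Matrix n n ℂ} (hR : R.IsHermitian) :
    sqrtM (R * R) = cfc (fun x : ℝ => |x|) R := by
  have hR' : IsSelfAdjoint R := hR
  have e : R * R = cfc (fun x : ℝ => x * x) R := by
    rw [cfc_mul _ _ R (continuousOn_spectrum _ _) (continuousOn_spectrum _ _), cfc_id' ℝ R]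
  rw [sqrtM, e, ← cfc_comp Real.sqrt _ R hR' Real.continuous_sqrt.continuousOn
    (continuousOn_spectrum _ _)]
  exact cfc_congr fun x _ => Real.sqrt_mul_self_eq_abs x

theorem sqrtM_mul_self_eq_self {R : Matrix n n ℂ} (hR : R.PosSemidef) : sqrtM (R * R) = R := by
  have hR' : IsSelfAdjoint R := hR.1
  rw [sqrtM_mul_self_eq hR.1]
  conv_rhs => rw [← cfc_id ℝ R]
  exact cfc_congr fun x hx => abs_of_nonneg (hR.spectrum_nonneg hx)

theorem trace_mul_nonneg {A B : Matrix n n ℂ} (hA : A.PosSemidef) (hB : B.PosSemidef) :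
    0 ≤ (A * B).trace.re := by
  have h := hA.mul_mul_conjTranspose_same (sqrtM B)
  rw [(sqrtM_posSemidef B).1.eq] at h
  have := (Complex.le_def.1 h.trace_nonneg).1
  rwa [Matrix.trace_mul_cycle, sqrtM_mul_self hB, Matrix.trace_mul_comm] at this

theorem hsNorm_sq {n : Type*} [Fintype n] (X : Matrix n n ℂ) : hsNorm X ^ 2 = (Xᴴ * X).trace.re :=
  Real.sq_sqrt (Complex.le_def.1 (posSemidef_conjTranspose_mul_self X).trace_nonneg).1

theorem hsNorm_sqrtM_sub_sq {A B : Matrix n n ℂ} (hA : A.PosSemidef) (hB : B.PosSemidef) :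
    hsNorm (sqrtM A - sqrtM B) ^ 2
      = A.trace.re + B.trace.re - 2 * (sqrtM A * sqrtM B).trace.re := by
  rw [hsNorm_sq, conjTranspose_sub, (sqrtM_posSemidef A).1.eq, (sqrtM_posSemidef B).1.eq,
    sub_mul, mul_sub, mul_sub, sqrtM_mul_self hA, sqrtM_mul_self hB]
  simp only [trace_sub, Complex.sub_re]
  rw [Matrix.trace_mul_comm (sqrtM B)]
  ring

theorem hsNorm_sqrtM_add_sq {A B : Matrix n n ℂ} (hA : A.PosSemidef) (hB : B.PosSemidef) :
    hsNorm (sqrtM A + sqrtM B) ^ 2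
      = A.trace.re + B.trace.re + 2 * (sqrtM A * sqrtM B).trace.re := by
  rw [hsNorm_sq, conjTranspose_add, (sqrtM_posSemidef A).1.eq, (sqrtM_posSemidef B).1.eq,
    add_mul, mul_add, mul_add, sqrtM_mul_self hA, sqrtM_mul_self hB]
  simp only [trace_add, Complex.add_re]
  rw [Matrix.trace_mul_comm (sqrtM B)]
  ring

theorem abs_trace_mul_le {n : Type*} [Fintype n] (X Y : Matrix n n ℂ) : |(X * Y).trace.re| ≤ hsNorm X * hsNorm Y := by
  refine (Complex.abs_re_le_norm _).trans ?_
  have h0 : 0 ≤ hsNorm X * hsNorm Y := mul_nonneg (Real.sqrt_nonneg _) (Real.sqrt_nonneg _)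
  rw [← pow_le_pow_iff_left₀ (norm_nonneg _) h0 two_ne_zero, mul_pow, hsNorm_sq, hsNorm_sq]
  exact norm_trace_mul_sq_le X Y

theorem hsNorm_mul_of_isometry {W : Matrix n n ℂ} (hW : Wᴴ * W = 1) (X : Matrix n n ℂ) :
    hsNorm (W * X) = hsNorm X := by
  rw [hsNorm, hsNorm, conjTranspose_mul, mul_assoc, ← mul_assoc Wᴴ, hW, one_mul]

theorem exists_traceNorm_eq {X : Matrix n n ℂ} (hX : X.IsHermitian) :
    ∃ W : Matrix n n ℂ, W.IsHermitian ∧ W * W = 1 ∧ traceNorm X = (W * X).trace.re := by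
  have hX' : IsSelfAdjoint X := hX
  -- The sign function, with value 1 at 0 so that W is an involution even for singular X.
  set s : ℝ → ℝ := fun x => if x < 0 then -1 else 1
  refine ⟨cfc s X, isHermitian_cfc X _, ?_, ?_⟩
  · rw [← cfc_mul _ _ X (continuousOn_spectrum _ _) (continuousOn_spectrum _ _),
      ← cfc_const_one ℝ X]
    refine cfc_congr fun x _ => ?_
    simp only [s]
    split_ifs <;> norm_num
  · rw [traceNorm, hX.eq, sqrtM_mul_self_eq hX]
    nth_rewrite 3 [← cfc_id ℝ X]
    rw [← cfc_mul _ _ X (continuousOn_spectrum _ _) (continuousOn_spectrum _ _)]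
    congr 2
    refine cfc_congr fun x _ => ?_
    simp only [s, id]
    split_ifs with h
    · simp [abs_of_neg h]
    · simp [abs_of_nonneg (not_lt.1 h)]

/-- The Powers–Størmer type inequality `‖A - B‖₁ ≤ ‖√A - √B‖₂ ‖√A + √B‖₂`. -/
theorem traceNorm_sub_le {A B : Matrix n n ℂ} (hA : A.PosSemidef) (hB : B.PosSemidef) :
    traceNorm (A - B) ≤ hsNorm (sqrtM A - sqrtM B) * hsNorm (sqrtM A + sqrtM B) := by
  obtain ⟨W, hW, hWW, h⟩ := exists_traceNorm_eq (hA.1.sub hB.1)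
  have hWi : Wᴴ * W = 1 := by rw [hW.eq, hWW]
  set D := sqrtM A - sqrtM B with hD
  set T := sqrtM A + sqrtM B with hT
  -- √A and √B need not commute, so the difference of squares is symmetrized: 2(A - B) = DT + TD.
  have e : (2 : ℂ) • (W * (A - B)) = W * D * T + W * T * D := by
    have : (2 : ℂ) • (A - B) = D * T + T * D := by
      rw [← sqrtM_mul_self hA, ← sqrtM_mul_self hB, two_smul, hD, hT]
      noncomm_ring
    rw [mul_assoc, mul_assoc, ← mul_add, ← this, mul_smul_comm]
  have e' := congrArg (fun M : Matrix n n ℂ => M.trace.re) e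
  simp only [trace_smul, trace_add, Complex.add_re, smul_eq_mul, Complex.mul_re, Complex.re_ofNat,
    Complex.im_ofNat, zero_mul, sub_zero] at e'
  have h1 := (le_abs_self _).trans (abs_trace_mul_le (W * D) T)
  have h2 := (le_abs_self _).trans (abs_trace_mul_le (W * T) D)
  rw [hsNorm_mul_of_isometry hWi] at h1 h2
  rw [h]
  linarith

theorem traceNorm_sub_sq_le {A B : Matrix n n ℂ} (hA : A.PosSemidef) (hB : B.PosSemidef)
    (hA1 : A.trace.re ≤ 1) (hB1 : B.trace.re ≤ 1) :
    1 / 4 * traceNorm (A - B) ^ 2 ≤ hsNorm (sqrtM A - sqrtM B) ^ 2 := by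
  have h0 : 0 ≤ traceNorm (A - B) := (Complex.le_def.1 (sqrtM_posSemidef _).trace_nonneg).1
  have h1 := pow_le_pow_left₀ h0 (traceNorm_sub_le hA hB) 2
  have h2 : hsNorm (sqrtM A + sqrtM B) ^ 2 ≤ 4 := by
    have h3 := sq_nonneg (hsNorm (sqrtM A - sqrtM B))
    -- Nonnegativity of ‖√A - √B‖₂² gives 2 Tr √A√B ≤ Tr A + Tr B ≤ 2.
    rw [hsNorm_sqrtM_sub_sq hA hB] at h3
    rw [hsNorm_sqrtM_add_sq hA hB]
    linarith
  rw [mul_pow] at h1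
  have h3 := mul_le_mul_of_nonneg_left h2 (sq_nonneg (hsNorm (sqrtM A - sqrtM B)))
  linarith

/-- `-2 log Tr (√ρ e^{G/2}) ≤ Tr ρ (log ρ - G)`. -/
theorem relEntropy_ge {ρ G : Matrix n n ℂ} (hρ : IsState ρ) (hG : G.IsHermitian) :
    0 < (sqrtM ρ * cfc (fun x => Real.exp (x / 2)) G).trace.re ∧
    -2 * Real.log (sqrtM ρ * cfc (fun x => Real.exp (x / 2)) G).trace.re ≤
      (ρ * logM ρ).trace.re - (ρ * G).trace.re := by
  have hρH : ρ.IsHermitian := hρ.1.1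
  have hρ' : IsSelfAdjoint ρ := hρH
  have hG' : IsSelfAdjoint G := hG
  obtain ⟨w, hw, h⟩ := hρH.exists_trace_cfc_mul_cfc hG
  have e1 := h id (fun _ => 1)
  have e2 := h Real.sqrt (fun x => Real.exp (x / 2))
  have e3 := h id id
  have e4 := h (fun x => x * Real.log x) (fun _ => 1)
  rw [cfc_mul _ _ ρ (continuousOn_spectrum _ _) (continuousOn_spectrum _ _), cfc_id' ℝ ρ] at e4
  simp only [cfc_const_one ℝ G, cfc_id ℝ ρ, cfc_id ℝ G, mul_one, hρ.2, Complex.one_re, id] at e1 e3 e4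
  rw [sqrtM, logM, e2, e3, e4]
  simp only [← Finset.sum_product'] at e1 ⊢
  set p : n × n → ℝ := fun x => hρH.eigenvalues x.1 with hp
  set g : n × n → ℝ := fun x => hG.eigenvalues x.2 with hg
  set v : n × n → ℝ := fun x => w x.1 x.2 with hv
  change 0 < ∑ x ∈ Finset.univ ×ˢ Finset.univ, √(p x) * Real.exp (g x / 2) * v x ∧
    -2 * Real.log (∑ x ∈ Finset.univ ×ˢ Finset.univ, √(p x) * Real.exp (g x / 2) * v x) ≤
    ∑ x ∈ Finset.univ ×ˢ Finset.univ, p x * Real.log (p x) * v x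
      - ∑ x ∈ Finset.univ ×ˢ Finset.univ, p x * g x * v x
  change 1 = ∑ x ∈ Finset.univ ×ˢ Finset.univ, p x * v x at e1
  have hp0 : ∀ x, 0 ≤ p x := fun x => hρ.1.eigenvalues_nonneg _
  have hv0 : ∀ x, 0 ≤ v x := fun x => hw _ _
  -- Jensen is applied at the points e^{g/2}/√p with probability weights p v. Where p = 0 the weight
  -- vanishes, and 1 merely keeps q in the domain of log.
  set q : n × n → ℝ := fun x => if p x = 0 then 1 else Real.exp (g x / 2) / √(p x) with hq
  have hq0 : ∀ x, 0 < q x := fun x => by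
    simp only [hq]
    split_ifs with h0
    · exact one_pos
    · have := (hp0 x).lt_of_ne' h0
      positivity
  have hpq : ∀ x, √(p x) * Real.exp (g x / 2) * v x = p x * v x * q x := fun x => by
    simp only [hq]
    split_ifs with h0
    · simp [h0]
    · have := Real.sqrt_ne_zero'.2 ((hp0 x).lt_of_ne' h0)
      nth_rewrite 2 [← Real.mul_self_sqrt (hp0 x)]
      field_simp
  have hlog : ∀ x, p x * v x * Real.log (q x)
      = -(1 / 2) * (p x * Real.log (p x) * v x - p x * g x * v x) := fun x => by
    simp only [hq]
    split_ifs with h0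
    · simp [h0]
    · have h1 := (hp0 x).lt_of_ne' h0
      rw [Real.log_div (Real.exp_pos _).ne' (Real.sqrt_ne_zero'.2 h1), Real.log_exp,
        Real.log_sqrt h1.le]
      ring
  have hJ := strictConcaveOn_log_Ioi.concaveOn.le_map_sum (t := Finset.univ ×ˢ Finset.univ)
    (w := fun x => p x * v x) (p := q) (fun x _ => mul_nonneg (hp0 x) (hv0 x)) e1.symm
    (fun x _ => hq0 x)
  simp only [smul_eq_mul, hlog, ← Finset.mul_sum] at hJ
  simp only [hpq]
  constructor
  · have hnn : ∀ x ∈ (Finset.univ ×ˢ Finset.univ : Finset (n × n)), 0 ≤ p x * v x * q x :=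
      fun x _ => mul_nonneg (mul_nonneg (hp0 x) (hv0 x)) (hq0 x).le
    refine (Finset.sum_nonneg hnn).lt_of_ne' fun h0 => ?_
    rw [Finset.sum_eq_zero_iff_of_nonneg hnn] at h0
    rw [Finset.sum_eq_zero] at e1
    · exact one_ne_zero e1
    · intro x hx
      exact (mul_eq_zero.1 (h0 x hx)).resolve_right (hq0 x).ne'
  · rw [← Finset.sum_sub_distrib]
    linarith
end Tripartite

/-! ### Supports, regularized logarithms and compression. -/

namespace Tripartite

open Matrix

section support

variable {n : Type*} [Fintype n] [DecidableEq n]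

theorem toEuclideanCLM_commonSupport (X Y : Matrix n n ℂ) :
    toEuclideanCLM (n := n) (𝕜 := ℂ) (commonSupport X Y) =
      (LinearMap.range (toEuclideanLin X) ⊓ LinearMap.range (toEuclideanLin Y)).starProjection :=
  StarAlgEquiv.apply_symm_apply _ _

theorem isHermitian_commonSupport (X Y : Matrix n n ℂ) : (commonSupport X Y).IsHermitian := by
  refine EquivLike.injective (toEuclideanCLM (n := n) (𝕜 := ℂ)) ?_
  rw [← star_eq_conjTranspose, map_star, toEuclideanCLM_commonSupport]
  exact isSelfAdjoint_starProjection _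

theorem commonSupport_mul_of_eq {X Y Z U V : Matrix n n ℂ} (h1 : Z = X * U) (h2 : Z = Y * V) :
    commonSupport X Y * Z = Z := by
  refine EquivLike.injective (toEuclideanCLM (n := n) (𝕜 := ℂ)) ?_
  ext1 v
  rw [map_mul, toEuclideanCLM_commonSupport, mul_apply_eq_comp,
    Submodule.starProjection_eq_self_iff]
  refine ⟨⟨toEuclideanCLM (n := n) (𝕜 := ℂ) U v, ?_⟩, ⟨toEuclideanCLM (n := n) (𝕜 := ℂ) V v, ?_⟩⟩
  · rw [h1, map_mul]; rfl
  · rw [h2, map_mul]; rfl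

theorem mul_commonSupport_eq_zero_of_left {X K : Matrix n n ℂ} (Y : Matrix n n ℂ) (h : K * X = 0) :
    K * commonSupport X Y = 0 := by
  refine EquivLike.injective (toEuclideanCLM (n := n) (𝕜 := ℂ)) ?_
  ext1 v
  rw [map_mul, toEuclideanCLM_commonSupport, mul_apply_eq_comp]
  obtain ⟨u, hu⟩ := (Submodule.starProjection_apply_mem
    (LinearMap.range (toEuclideanLin X) ⊓ LinearMap.range (toEuclideanLin Y)) v).1
  rw [← hu, map_zero, _root_.zero_apply]
  change (toEuclideanCLM (n := n) (𝕜 := ℂ) K * toEuclideanCLM (n := n) (𝕜 := ℂ) X) u = 0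
  rw [← map_mul, h, map_zero, _root_.zero_apply]

theorem mul_commonSupport_eq_zero_of_right {Y K : Matrix n n ℂ} (X : Matrix n n ℂ)
    (h : K * Y = 0) : K * commonSupport X Y = 0 := by
  have : commonSupport X Y = commonSupport Y X := by
    unfold commonSupport; simp only [inf_comm]
  rw [this]
  exact mul_commonSupport_eq_zero_of_left X h

theorem commonSupport_mul_self (X Y : Matrix n n ℂ) :
    commonSupport X Y * commonSupport X Y = commonSupport X Y := by
  refine EquivLike.injective (toEuclideanCLM (n := n) (𝕜 := ℂ)) ?_
  rw [map_mul, toEuclideanCLM_commonSupport]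
  exact (isStarProjection_starProjection (U := LinearMap.range (toEuclideanLin X) ⊓
    LinearMap.range (toEuclideanLin Y))).isIdempotentElem

/-- The orthogonal projection onto the kernel of a Hermitian matrix. -/
noncomputable def kernelProj (X : Matrix n n ℂ) : Matrix n n ℂ := cfc (fun x : ℝ => if x = 0 then 1 else 0) X

theorem kernelProj_posSemidef (X : Matrix n n ℂ) : (kernelProj X).PosSemidef :=
  posSemidef_cfc fun x _ => by split_ifs <;> norm_num

theorem kernelProj_mul_self {X : Matrix n n ℂ} (hX : X.IsHermitian) : kernelProj X * X = 0 := by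
  have hX' : IsSelfAdjoint X := hX
  nth_rewrite 2 [← cfc_id ℝ X]
  rw [kernelProj, ← cfc_mul _ _ X (continuousOn_spectrum _ _) (continuousOn_spectrum _ _),
    ← cfc_const_zero ℝ X]
  exact cfc_congr fun x _ => by simp

theorem exists_mul_eq_one_sub_kernelProj {X : Matrix n n ℂ} (hX : X.IsHermitian) :
    ∃ R, X * R = 1 - kernelProj X := by
  have hX' : IsSelfAdjoint X := hX
  -- The pseudo-inverse: 0⁻¹ = 0 makes x · x⁻¹ the indicator of x ≠ 0.
  refine ⟨cfc (fun x : ℝ => x⁻¹) X, ?_⟩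
  nth_rewrite 1 [← cfc_id ℝ X]
  rw [kernelProj, ← cfc_mul _ _ X (continuousOn_spectrum _ _) (continuousOn_spectrum _ _),
    ← cfc_const_one ℝ X,
    ← cfc_sub _ _ X (continuousOn_spectrum _ _) (continuousOn_spectrum _ _)]
  refine cfc_congr fun x _ => ?_
  by_cases h : x = 0 <;> simp [h]

/-- `log (X + ε)`. -/
noncomputable def regLog (ε : ℝ) (X : Matrix n n ℂ) : Matrix n n ℂ := cfc (fun x : ℝ => Real.log (x + ε)) X

theorem exp_regLog {ε : ℝ} (hε : 0 < ε) {X : Matrix n n ℂ} (hX : X.PosSemidef) :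
    NormedSpace.exp (regLog ε X) = X + ε • (1 : Matrix n n ℂ) := by
  have hX' : IsSelfAdjoint X := hX.1
  have e : X + ε • (1 : Matrix n n ℂ) = cfc (fun x : ℝ => x + ε) X := by
    rw [cfc_add X _ _ (continuousOn_spectrum _ _) (continuousOn_spectrum _ _), cfc_id' ℝ X,
      cfc_const ε X, Algebra.algebraMap_eq_smul_one]
  rw [regLog, (isHermitian_cfc X _).exp_eq_cfc, e,
    ← cfc_comp Real.exp _ X hX' Real.continuous_exp.continuousOn (continuousOn_spectrum _ _)]
  exact cfc_congr fun x hx => Real.exp_log (by linarith [hX.spectrum_nonneg hx])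

/-- Off the kernel log (x + ε) ≥ log x, which gives M. The term log ε, unbounded below as ε → 0,
sits on the kernel and is later killed by P. -/
theorem exists_regLog_eq {ε : ℝ} (hε : 0 < ε) {X : Matrix n n ℂ} (hX : X.PosSemidef) :
    ∃ M, M.PosSemidef ∧ regLog ε X = logM X + M + Real.log ε • kernelProj X := by
  refine ⟨cfc (fun x : ℝ => if x = 0 then 0 else Real.log (x + ε) - Real.log x) X,
    posSemidef_cfc fun x hx => ?_, ?_⟩
  · split_ifs with h
    · exact le_rfl
    · have := (hX.spectrum_nonneg hx).lt_of_ne' h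
      exact sub_nonneg.2 (Real.log_le_log this (by linarith))
  · rw [kernelProj, logM, ← cfc_smul (Real.log ε) _ X (continuousOn_spectrum _ _),
      ← cfc_add X _ _ (continuousOn_spectrum _ _) (continuousOn_spectrum _ _),
      ← cfc_add X _ _ (continuousOn_spectrum _ _) (continuousOn_spectrum _ _), regLog]
    refine cfc_congr fun x _ => ?_
    by_cases h : x = 0 <;> simp [h]

end support

section compression

variable {n : Type*} [Fintype n] [DecidableEq n] {P G : Matrix n n ℂ}

theorem mul_eq_self_of_mul_eq_self {n : Type*} [Fintype n] {P G : Matrix n n ℂ} (hP : P.IsHermitian) (hG : G.IsHermitian) (h : P * G = G) :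
    G * P = G := by
  simpa [hP.eq, hG.eq] using congrArg conjTranspose h

theorem posSemidef_mul_exp_mul (hP : P.IsHermitian) (hG : G.IsHermitian) :
    (P * NormedSpace.exp G * P).PosSemidef := by
  have h : (NormedSpace.exp G).PosSemidef := by
    rw [hG.exp_eq_cfc]
    exact posSemidef_cfc fun x _ => (Real.exp_pos x).le
  simpa [hP.eq] using h.mul_mul_conjTranspose_same P

/-- P commutes with G, hence with e^{G/2}, so the right side is positive semidefinite with the
required square. -/
theorem sqrtM_mul_exp_mul (hP : P.IsHermitian) (hPP : P * P = P) (hG : G.IsHermitian)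
    (hPG : P * G = G) :
    sqrtM (P * NormedSpace.exp G * P) = P * cfc (fun x : ℝ => Real.exp (x / 2)) G * P := by
  have hG' : IsSelfAdjoint G := hG
  have hc : Commute G P := (mul_eq_self_of_mul_eq_self hP hG hPG).trans hPG.symm
  set E := cfc (fun x : ℝ => Real.exp (x / 2)) G with hE
  have hEP : E * P = P * E := (hc.cfc_real _).eq
  have hEE : NormedSpace.exp G = E * E := by
    rw [hG.exp_eq_cfc, hE,
      ← cfc_mul _ _ G (continuousOn_spectrum _ _) (continuousOn_spectrum _ _)]
    exact cfc_congr fun x _ => by rw [← Real.exp_add]; ring_nf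
  have hR : (P * E * P).PosSemidef := by
    have h : E.PosSemidef := posSemidef_cfc fun x _ => (Real.exp_pos _).le
    simpa [hP.eq] using h.mul_mul_conjTranspose_same P
  have e : P * NormedSpace.exp G * P = (P * E * P) * (P * E * P) := by
    rw [hEE]
    calc P * (E * E) * P = P * P * E * E * P := by rw [hPP]; simp only [mul_assoc]
      _ = P * (P * E) * E * P := by simp only [mul_assoc]
      _ = P * (E * P) * E * P := by rw [hEP]
      _ = P * E * (P * P) * E * P := by rw [hPP]; simp only [mul_assoc]
      _ = _ := by simp only [mul_assoc]
  rw [e, sqrtM_mul_self_eq_self hR]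

/-- A form of the Peierls inequality: compressing to a subspace decreases the trace of the
exponential. -/
theorem trace_mul_exp_mul_le {L : Matrix n n ℂ} (hP : P.IsHermitian) (hPP : P * P = P)
    (hG : G.IsHermitian) (hPG : P * G = G) (hL : L.IsHermitian) (h : (P * L * P - G).PosSemidef) :
    (P * NormedSpace.exp G * P).trace.re ≤ (NormedSpace.exp L).trace.re := by
  have hGP := mul_eq_self_of_mul_eq_self hP hG hPG
  set Q := 1 - P with hQ
  have hQH : Q.IsHermitian := isHermitian_one.sub hP
  have hPQ : P * Q = 0 := by rw [hQ, mul_sub, hPP, mul_one, sub_self]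
  have hQP : Q * P = 0 := by rw [hQ, sub_mul, hPP, one_mul, sub_self]
  -- Klein's inequality is used at the block-diagonal G + K against L. Its exponential F is block
  -- diagonal too, so the off-diagonal blocks of L drop out, leaving Tr F(PLP - G) ≥ 0; finally Tr
  -- QFQ ≥ 0 is discarded.
  set K := Q * L * Q with hK
  have hKH : K.IsHermitian := by
    simpa [hQH.eq] using isHermitian_mul_mul_conjTranspose Q hL
  have hPK : P * K = 0 := by rw [hK, ← mul_assoc, ← mul_assoc, hPQ, zero_mul, zero_mul]
  have hKP : K * P = 0 := by rw [hK, mul_assoc, hQP, mul_zero]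
  have hGK : G * K = 0 := by rw [← hGP, mul_assoc, hPK, mul_zero]
  have hKG : K * G = 0 := by rw [← hPG, ← mul_assoc, hKP, zero_mul]
  have hcP : Commute (NormedSpace.exp (G + K)) P := by
    refine Commute.exp_left ?_
    rw [Commute, SemiconjBy, add_mul, mul_add, hGP, hPG, hKP, hPK]
  set F := NormedSpace.exp (G + K) with hF
  have hFp : F.PosSemidef := by
    rw [hF, (hG.add hKH).exp_eq_cfc]
    exact posSemidef_cfc fun x _ => (Real.exp_pos x).le
  have hexpK : NormedSpace.exp K * P = P := by
    have hK' : IsSelfAdjoint K := hKH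
    -- Dividing by zero at x = 0 is harmless, since the quotient is multiplied by x.
    have e : NormedSpace.exp K = 1 + cfc (fun x : ℝ => (Real.exp x - 1) / x) K * K := by
      nth_rewrite 3 [← cfc_id ℝ K]
      rw [hKH.exp_eq_cfc, ← cfc_const_one ℝ K,
        ← cfc_mul _ _ K (continuousOn_spectrum _ _) (continuousOn_spectrum _ _),
        ← cfc_add K _ _ (continuousOn_spectrum _ _) (continuousOn_spectrum _ _)]
      refine cfc_congr fun x _ => ?_
      by_cases hx : x = 0 <;> simp [hx]
    rw [e, add_mul, mul_assoc, hKP, mul_zero, one_mul, add_zero]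
  have hFG : P * NormedSpace.exp G * P = P * F * P := by
    rw [hF, Matrix.exp_add_of_commute _ _ (hGK.trans hKG.symm), mul_assoc, mul_assoc, mul_assoc,
      hexpK]
  have hQFQ : 0 ≤ (Q * F * Q).trace.re := by
    have := hFp.mul_mul_conjTranspose_same Q
    rw [hQH.eq] at this
    exact (Complex.le_def.1 this.trace_nonneg).1
  have hsplit : F = P * F * P + Q * F * Q := by
    have e1 : P * F * P = F * P := by rw [← hcP.eq, mul_assoc, hPP]
    have e2 : Q * F * Q = F * Q := by
      rw [hQ, sub_mul, one_mul, ← hcP.eq, mul_sub, sub_mul, sub_mul, mul_assoc F P P, hPP, mul_one,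
        mul_one, sub_self, sub_zero, mul_sub, mul_one]
    rw [e1, e2, ← mul_add, hQ, add_sub_cancel, mul_one]
  have hdiff : (F * (L - (G + K))).trace = (F * (P * L * P - G)).trace := by
    have e1 : (F * L).trace = (F * (P * L * P)).trace + (F * (Q * L * Q)).trace := by
      have a1 : (F * (P * L * P)).trace = (P * F * P * L).trace := by
        rw [← mul_assoc, Matrix.trace_mul_comm]; simp only [mul_assoc]
      have a2 : (F * (Q * L * Q)).trace = (Q * F * Q * L).trace := by
        rw [← mul_assoc, Matrix.trace_mul_comm]; simp only [mul_assoc]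
      rw [a1, a2, ← trace_add, ← add_mul, ← hsplit]
    rw [mul_sub, mul_add, mul_sub, trace_sub, trace_add, trace_sub, e1]
    ring
  have hKl := (hG.add hKH).trace_exp_add_trace_exp_mul_sub_le hL
  rw [← hF, hdiff] at hKl
  have h1 := trace_mul_nonneg hFp h
  have h2 : F.trace.re = (P * F * P).trace.re + (Q * F * Q).trace.re := by
    conv_lhs => rw [hsplit, trace_add, Complex.add_re]
  rw [hFG]
  linarith

end compression

end Tripartite

/-! ### Partial traces and the embeddings of AB and BC. -/

namespace Tripartite

open Matrix

section reduced

variable {a b c : Type*}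

theorem tensorIdC_apply [DecidableEq c] (X : Matrix (a × b) (a × b) ℂ) (p q : a × b × c) :
    tensorIdC X p q = X (p.1, p.2.1) (q.1, q.2.1) * if p.2.2 = q.2.2 then 1 else 0 := by
  simp [tensorIdC, Matrix.one_apply]

theorem idTensorA_apply [DecidableEq a] (Y : Matrix (b × c) (b × c) ℂ) (p q : a × b × c) :
    idTensorA Y p q = (if p.1 = q.1 then 1 else 0) * Y p.2 q.2 := by
  simp [idTensorA, Matrix.one_apply, Matrix.kroneckerMap_apply]

theorem posSemidef_margAB [Fintype c] {ρ : Matrix (a × b × c) (a × b × c) ℂ} (hρ : ρ.PosSemidef) :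
    (margAB ρ).PosSemidef := by
  have : margAB ρ = ∑ k, ρ.submatrix (fun p : a × b => (p.1, p.2, k)) fun p => (p.1, p.2, k) := by
    ext p q
    simp [margAB, Matrix.sum_apply]
  rw [this]
  exact posSemidef_sum _ fun k _ => hρ.submatrix _

theorem posSemidef_margBC [Fintype a] {ρ : Matrix (a × b × c) (a × b × c) ℂ} (hρ : ρ.PosSemidef) :
    (margBC ρ).PosSemidef := by
  have : margBC ρ = ∑ i, ρ.submatrix (fun p : b × c => (i, p)) fun p => (i, p) := by
    ext p q
    simp [margBC, Matrix.sum_apply]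
  rw [this]
  exact posSemidef_sum _ fun k _ => hρ.submatrix _

/-- The reduced matrix `ρ_B`. -/
def margB [Fintype a] [Fintype c] (ρ : Matrix (a × b × c) (a × b × c) ℂ) : Matrix b b ℂ :=
  ∑ i, ∑ k, ρ.submatrix (fun j => (i, j, k)) fun j => (i, j, k)

theorem posSemidef_margB [Fintype a] [Fintype c] {ρ : Matrix (a × b × c) (a × b × c) ℂ} (hρ : ρ.PosSemidef) :
    (margB ρ).PosSemidef :=
  posSemidef_sum _ fun _ _ => posSemidef_sum _ fun _ _ => hρ.submatrix _

theorem trace_margB [Fintype a] [Fintype b] [Fintype c] (ρ : Matrix (a × b × c) (a × b × c) ℂ) : (margB ρ).trace = ρ.trace := by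
  simp only [margB, Matrix.trace, diag_apply, Matrix.sum_apply, submatrix_apply,
    Fintype.sum_prod_type]
  rw [Finset.sum_comm]

theorem trace_mul_tensorIdC [Fintype a] [Fintype b] [Fintype c] [DecidableEq c]
    (ρ : Matrix (a × b × c) (a × b × c) ℂ)
    (X : Matrix (a × b) (a × b) ℂ) : (ρ * tensorIdC X).trace = (margAB ρ * X).trace := by
  simp only [Matrix.trace, diag_apply, mul_apply, tensorIdC_apply, margAB, Fintype.sum_prod_type,
    Finset.sum_mul]
  simp only [mul_ite, mul_one, mul_zero, Finset.sum_ite_eq', Finset.mem_univ, if_true]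
  refine Finset.sum_congr rfl fun i _ => Finset.sum_congr rfl fun j _ => ?_
  rw [Finset.sum_comm]
  refine Finset.sum_congr rfl fun i' _ => ?_
  rw [Finset.sum_comm]

theorem trace_mul_idTensorA [Fintype a] [DecidableEq a] [Fintype b] [Fintype c]
    (ρ : Matrix (a × b × c) (a × b × c) ℂ)
    (Y : Matrix (b × c) (b × c) ℂ) :
    (ρ * idTensorA Y).trace = (margBC ρ * Y).trace := by
  simp only [Matrix.trace, diag_apply, mul_apply, idTensorA_apply, margBC,
    Fintype.sum_prod_type (α₁ := a), Finset.sum_mul]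
  rw [Finset.sum_comm]
  refine Finset.sum_congr rfl fun p _ => ?_
  rw [Finset.sum_comm (γ := b × c)]
  refine Finset.sum_congr rfl fun i _ => ?_
  rw [Finset.sum_comm]
  simp only [ite_mul, one_mul, zero_mul, mul_ite, mul_zero, Finset.sum_ite_eq', Finset.mem_univ,
    if_true]

/-- Tracing A out of ρ_AB ⊗ 1 leaves ρ_B ⊗ 1_C; pairing this with ρ_BC traces out C. -/
theorem trace_tensorIdC_margAB_mul [Fintype a] [DecidableEq a] [Fintype b] [Fintype c]
    [DecidableEq c] (ρ : Matrix (a × b × c) (a × b × c) ℂ) :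
    (tensorIdC (margAB ρ) * idTensorA (margBC ρ)).trace = (margB ρ * margB ρ).trace := by
  rw [trace_mul_idTensorA]
  have h1 : ∀ j k j' k', margBC (tensorIdC (c := c) (margAB ρ)) (j, k) (j', k')
      = margB ρ j j' * if k = k' then 1 else 0 := by
    intro j k j' k'
    simp only [margBC, tensorIdC_apply, margAB, margB, Matrix.sum_apply,
      submatrix_apply]
    rw [Finset.sum_mul]
  have h2 : ∀ j j', ∑ k, margBC ρ (j, k) (j', k) = margB ρ j j' := by
    intro j j'
    simp only [margBC, margB, Matrix.sum_apply, submatrix_apply]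
    rw [Finset.sum_comm]
  simp only [Matrix.trace, diag_apply, mul_apply, Fintype.sum_prod_type, h1]
  refine Finset.sum_congr rfl fun j _ => ?_
  simp only [mul_ite, ite_mul, mul_one, mul_zero, zero_mul, Finset.sum_ite_eq, Finset.mem_univ,
    if_true]
  rw [Finset.sum_comm]
  refine Finset.sum_congr rfl fun j' _ => ?_
  rw [← Finset.mul_sum, h2]

end reduced

variable {a b c : Type*} [Fintype a] [DecidableEq a] [Fintype b] [DecidableEq b]
  [Fintype c] [DecidableEq c]

/-- `X ↦ X ⊗ 1_C` as a ring homomorphism. -/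
def tensorIdCHom : Matrix (a × b) (a × b) ℂ →+* Matrix (a × b × c) (a × b × c) ℂ where
  toFun := tensorIdC
  map_one' := by simp [tensorIdC]
  map_mul' X Y := by
    simp [tensorIdC, Matrix.submatrix_mul_equiv, ← Matrix.mul_kronecker_mul]
  map_zero' := by simp [tensorIdC]
  map_add' X Y := by
    simp only [tensorIdC, Matrix.add_kronecker]
    rfl

/-- `Y ↦ 1_A ⊗ Y` as a ring homomorphism. -/
def idTensorAHom : Matrix (b × c) (b × c) ℂ →+* Matrix (a × b × c) (a × b × c) ℂ where
  toFun := idTensorA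
  map_one' := by simp [idTensorA]
  map_mul' X Y := by simp [idTensorA, ← Matrix.mul_kronecker_mul]
  map_zero' := by simp [idTensorA]
  map_add' X Y := by simp [idTensorA, Matrix.kronecker_add]

theorem tensorIdCHom_conjTranspose (X : Matrix (a × b) (a × b) ℂ) :
    tensorIdCHom (c := c) Xᴴ = (tensorIdCHom X)ᴴ := by
  ext p q
  change tensorIdC Xᴴ p q = star (tensorIdC X q p)
  simp only [tensorIdC_apply, conjTranspose_apply, star_mul', eq_comm (a := q.2.2)]
  split_ifs <;> simp

theorem idTensorAHom_conjTranspose (Y : Matrix (b × c) (b × c) ℂ) :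
    idTensorAHom (a := a) Yᴴ = (idTensorAHom Y)ᴴ := by
  ext p q
  change idTensorA Yᴴ p q = star (idTensorA Y q p)
  simp only [idTensorA_apply, conjTranspose_apply, star_mul', eq_comm (a := q.1)]
  split_ifs <;> simp

theorem tensorIdCHom_smul (r : ℝ) (X : Matrix (a × b) (a × b) ℂ) :
    tensorIdCHom (c := c) (r • X) = r • tensorIdCHom X := by
  ext p q
  change tensorIdC (r • X) p q = r • tensorIdC X p q
  simp only [tensorIdC_apply, Matrix.smul_apply, smul_mul_assoc]

theorem idTensorAHom_smul (r : ℝ) (Y : Matrix (b × c) (b × c) ℂ) :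
    idTensorAHom (a := a) (r • Y) = r • idTensorAHom Y := by
  ext p q
  change idTensorA (r • Y) p q = r • idTensorA Y p q
  simp only [idTensorA_apply, Matrix.smul_apply, mul_smul_comm]

theorem continuous_tensorIdCHom :
    Continuous (tensorIdCHom : Matrix (a × b) (a × b) ℂ →+* Matrix (a × b × c) (a × b × c) ℂ) := by
  refine continuous_matrix fun p q => ?_
  change Continuous fun X => tensorIdC X p q
  simp only [tensorIdC_apply]
  fun_prop

theorem continuous_idTensorAHom :
    Continuous (idTensorAHom : Matrix (b × c) (b × c) ℂ →+* Matrix (a × b × c) (a × b × c) ℂ) := by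
  refine continuous_matrix fun p q => ?_
  change Continuous fun X => idTensorA X p q
  simp only [idTensorA_apply]
  fun_prop

theorem map_exp_of_continuous {m n : Type*} [Fintype m] [DecidableEq m] [Fintype n] [DecidableEq n]
    (f : Matrix m m ℂ →+* Matrix n n ℂ) (hf : Continuous f) (X : Matrix m m ℂ) :
    f (NormedSpace.exp X) = NormedSpace.exp (f X) := by
  let _ : NormedRing (Matrix m m ℂ) := Matrix.linftyOpNormedRing
  let _ : NormedAlgebra ℚ (Matrix m m ℂ) := Matrix.linftyOpNormedAlgebra
  let _ : NormedRing (Matrix n n ℂ) := Matrix.linftyOpNormedRing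
  have : @CompleteSpace (Matrix m m ℂ) PseudoMetricSpace.toUniformSpace :=
    inferInstanceAs (CompleteSpace (m → m → ℂ))
  exact NormedSpace.map_exp f hf X

theorem posSemidef_map {m n : Type*} [Fintype m] [DecidableEq m] [Fintype n]
    [DecidableEq n] (f : Matrix m m ℂ →+* Matrix n n ℂ) (hf : ∀ X, f Xᴴ = (f X)ᴴ)
    {X : Matrix m m ℂ} (hX : X.PosSemidef) : (f X).PosSemidef := by
  rw [← sqrtM_mul_self hX, map_mul]
  nth_rewrite 1 [← (sqrtM_posSemidef X).1.eq]
  rw [hf]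
  exact posSemidef_conjTranspose_mul_self _

theorem isHermitian_map {m n : Type*} {f : Matrix m m ℂ → Matrix n n ℂ}
    (hf : ∀ X, f Xᴴ = (f X)ᴴ) {X : Matrix m m ℂ} (hX : X.IsHermitian) : (f X).IsHermitian := by
  rw [IsHermitian, ← hf, hX.eq]

/-- Tr ρK is the squared Hilbert–Schmidt norm of √ρ√K. -/
theorem mul_eq_zero_of_trace_mul_eq_zero {n : Type*} [Fintype n] [DecidableEq n]
    {ρ K : Matrix n n ℂ} (hρ : ρ.PosSemidef) (hK : K.PosSemidef) (h : (ρ * K).trace = 0) :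
    K * ρ = 0 := by
  have e : ((sqrtM ρ * sqrtM K)ᴴ * (sqrtM ρ * sqrtM K)).trace = 0 := by
    rw [conjTranspose_mul, (sqrtM_posSemidef ρ).1.eq, (sqrtM_posSemidef K).1.eq, mul_assoc,
      ← mul_assoc (sqrtM ρ), sqrtM_mul_self hρ, Matrix.trace_mul_comm, mul_assoc,
      sqrtM_mul_self hK, h]
  have e1 := (trace_conjTranspose_mul_self_eq_zero_iff).1 e
  have e2 : ρ * K = 0 := by
    calc ρ * K = sqrtM ρ * (sqrtM ρ * sqrtM K) * sqrtM K := by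
          rw [← mul_assoc, sqrtM_mul_self hρ, mul_assoc, sqrtM_mul_self hK]
      _ = 0 := by rw [e1, mul_zero, zero_mul]
  simpa [hρ.1.eq, hK.1.eq] using congrArg conjTranspose e2

/-! ### The support of ρ and the bound Tr σ ≤ 1. -/

variable {ρ : Matrix (a × b × c) (a × b × c) ℂ}

/-- This encodes supp ρ ⊆ supp (ρ_AB ⊗ 1). If K projects onto ker ρ_AB, then Tr ρ(K ⊗ 1) = Tr ρ_AB K
= 0, so K ⊗ 1 annihilates ρ. -/
theorem exists_tensorIdC_mul_eq (hρ : ρ.PosSemidef) : ∃ U, ρ = tensorIdC (margAB ρ) * U := by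
  have hX := (posSemidef_margAB hρ).1
  obtain ⟨R, hR⟩ := exists_mul_eq_one_sub_kernelProj hX
  have h := mul_eq_zero_of_trace_mul_eq_zero hρ
    (posSemidef_map tensorIdCHom (tensorIdCHom_conjTranspose (c := c))
      (kernelProj_posSemidef (margAB ρ))) (by
    refine (trace_mul_tensorIdC ρ _).trans ?_
    rw [Matrix.trace_mul_comm, kernelProj_mul_self hX, Matrix.trace_zero])
  refine ⟨tensorIdCHom R * ρ, ?_⟩
  change _ = tensorIdCHom (margAB ρ) * _
  rw [← mul_assoc, ← map_mul, hR, map_sub, map_one, sub_mul, h, one_mul, sub_zero]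

theorem exists_idTensorA_mul_eq (hρ : ρ.PosSemidef) : ∃ V, ρ = idTensorA (margBC ρ) * V := by
  have hX := (posSemidef_margBC hρ).1
  obtain ⟨R, hR⟩ := exists_mul_eq_one_sub_kernelProj hX
  have h := mul_eq_zero_of_trace_mul_eq_zero hρ
    (posSemidef_map idTensorAHom (idTensorAHom_conjTranspose (a := a))
      (kernelProj_posSemidef (margBC ρ))) (by
    refine (trace_mul_idTensorA ρ _).trans ?_
    rw [Matrix.trace_mul_comm, kernelProj_mul_self hX, Matrix.trace_zero])
  refine ⟨idTensorAHom R * ρ, ?_⟩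
  change _ = idTensorAHom (margBC ρ) * _
  rw [← mul_assoc, ← map_mul, hR, map_sub, map_one, sub_mul, h, one_mul, sub_zero]

/-- The projection entering the definition of `expLogSum`. -/
noncomputable def suppProj (ρ : Matrix (a × b × c) (a × b × c) ℂ) :
    Matrix (a × b × c) (a × b × c) ℂ :=
  commonSupport (tensorIdC (margAB ρ)) (idTensorA (margBC ρ))

theorem suppProj_mul (hρ : ρ.PosSemidef) : suppProj ρ * ρ = ρ := by
  obtain ⟨U, hU⟩ := exists_tensorIdC_mul_eq hρ
  obtain ⟨V, hV⟩ := exists_idTensorA_mul_eq hρ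
  exact commonSupport_mul_of_eq hU hV

theorem isHermitian_logSum (ρ : Matrix (a × b × c) (a × b × c) ℂ) : (logSum ρ).IsHermitian :=
  (isHermitian_map (f := tensorIdCHom) tensorIdCHom_conjTranspose (isHermitian_cfc _ _)).add
    (isHermitian_map (f := idTensorAHom) idTensorAHom_conjTranspose (isHermitian_cfc _ _))

theorem isHermitian_suppProj_mul_logSum_mul (ρ : Matrix (a × b × c) (a × b × c) ℂ) :
    (suppProj ρ * logSum ρ * suppProj ρ).IsHermitian := by
  have hP : (suppProj ρ).IsHermitian := isHermitian_commonSupport _ _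
  simpa [hP.eq] using isHermitian_mul_mul_conjTranspose (suppProj ρ) (isHermitian_logSum ρ)

theorem suppProj_mul_compression (ρ : Matrix (a × b × c) (a × b × c) ℂ) :
    suppProj ρ * (suppProj ρ * logSum ρ * suppProj ρ) = suppProj ρ * logSum ρ * suppProj ρ := by
  have hPP : suppProj ρ * suppProj ρ = suppProj ρ := commonSupport_mul_self _ _
  rw [← mul_assoc, ← mul_assoc, hPP]

theorem suppProj_mul_map_kernelProj_mul {m : Type*} [Fintype m] [DecidableEq m]
    {f : Matrix m m ℂ →+* Matrix (a × b × c) (a × b × c) ℂ} {X : Matrix m m ℂ}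
    (h : f (kernelProj X) * suppProj ρ = 0) (hf : ∀ (r : ℝ) X, f (r • X) = r • f X) (r : ℝ)
    (hfs : ∀ X, f Xᴴ = (f X)ᴴ) {M : Matrix m m ℂ} (hM : M.PosSemidef) :
    (suppProj ρ * f (M + r • kernelProj X) * suppProj ρ).PosSemidef := by
  have hP : (suppProj ρ).IsHermitian := isHermitian_commonSupport _ _
  rw [map_add, hf, mul_add, add_mul, mul_assoc _ (r • _), smul_mul_assoc, h, smul_zero, mul_zero,
    add_zero]
  simpa [hP.eq] using (posSemidef_map f hfs hM).mul_mul_conjTranspose_same (suppProj ρ)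

/-- Compressed by P, the regularized logarithms dominate `logSum`, since their kernel terms vanish
there. Peierls then removes the compression and Golden–Thompson splits the exponential. -/
theorem trace_expLogSum_le_add (hρ : ρ.PosSemidef) {ε : ℝ} (hε : 0 < ε) :
    (expLogSum ρ).trace.re ≤ ((tensorIdCHom (margAB ρ) + ε • 1) *
      (idTensorAHom (margBC ρ) + ε • 1)).trace.re := by
  have hX := posSemidef_margAB hρ
  have hY := posSemidef_margBC hρ
  obtain ⟨M, hM, hMe⟩ := exists_regLog_eq hε hX
  obtain ⟨N, hN, hNe⟩ := exists_regLog_eq hε hY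
  have hP : (suppProj ρ).IsHermitian := isHermitian_commonSupport _ _
  have hH : (tensorIdCHom (c := c) (regLog ε (margAB ρ))).IsHermitian :=
    isHermitian_map tensorIdCHom_conjTranspose (isHermitian_cfc _ _)
  have hK : (idTensorAHom (a := a) (regLog ε (margBC ρ))).IsHermitian :=
    isHermitian_map idTensorAHom_conjTranspose (isHermitian_cfc _ _)
  have hk1 : tensorIdCHom (kernelProj (margAB ρ)) * suppProj ρ = 0 := by
    refine mul_commonSupport_eq_zero_of_left _ ?_
    change _ * tensorIdCHom (margAB ρ) = 0
    rw [← map_mul, kernelProj_mul_self hX.1, map_zero]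
  have hk2 : idTensorAHom (kernelProj (margBC ρ)) * suppProj ρ = 0 := by
    refine mul_commonSupport_eq_zero_of_right _ ?_
    change _ * idTensorAHom (margBC ρ) = 0
    rw [← map_mul, kernelProj_mul_self hY.1, map_zero]
  have hpsd := (suppProj_mul_map_kernelProj_mul hk1 tensorIdCHom_smul (Real.log ε)
    tensorIdCHom_conjTranspose hM).add (suppProj_mul_map_kernelProj_mul hk2 idTensorAHom_smul
    (Real.log ε) idTensorAHom_conjTranspose hN)
  have h := trace_mul_exp_mul_le (G := suppProj ρ * logSum ρ * suppProj ρ) hP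
    (commonSupport_mul_self _ _) (isHermitian_suppProj_mul_logSum_mul ρ)
    (suppProj_mul_compression ρ) (hH.add hK) (by
      convert hpsd using 1
      have : logSum ρ = tensorIdCHom (logM (margAB ρ)) + idTensorAHom (logM (margBC ρ)) := rfl
      rw [this, hMe, hNe, add_assoc, add_assoc, map_add tensorIdCHom, map_add idTensorAHom]
      noncomm_ring)
  refine h.trans ((hH.trace_exp_add_le hK).trans_eq ?_)
  rw [← map_exp_of_continuous _ continuous_tensorIdCHom,
    ← map_exp_of_continuous _ continuous_idTensorAHom, exp_regLog hε hX, exp_regLog hε hY,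
    map_add, map_add, tensorIdCHom_smul, idTensorAHom_smul, map_one, map_one]

open Filter Topology in
theorem trace_expLogSum_le (hρ : IsState ρ) : (expLogSum ρ).trace.re ≤ 1 := by
  have hc : Continuous fun ε : ℝ => ((tensorIdCHom (margAB ρ) + ε • 1) *
      (idTensorAHom (margBC ρ) + ε • 1)).trace.re := by fun_prop
  have ht := (hc.tendsto 0).mono_left (nhdsWithin_le_nhds (s := Set.Ioi 0))
  have h := ge_of_tendsto ht (by
    filter_upwards [self_mem_nhdsWithin] with ε hε using trace_expLogSum_le_add hρ.1 hε)
  refine h.trans ?_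
  simp only [zero_smul, add_zero]
  change (tensorIdC (margAB ρ) * idTensorA (margBC ρ)).trace.re ≤ 1
  rw [trace_tensorIdC_margAB_mul]
  refine (posSemidef_margB hρ.1).trace_mul_self_le.trans ?_
  rw [trace_margB, hρ.2]
  simp

theorem sqrtM_mul_suppProj (hρ : ρ.PosSemidef) : sqrtM ρ * suppProj ρ = sqrtM ρ := by
  have hP : (suppProj ρ).IsHermitian := isHermitian_commonSupport _ _
  have h : (suppProj ρ - 1) * ρ = 0 := by rw [sub_mul, suppProj_mul hρ, one_mul, sub_self]
  have e : ((sqrtM ρ * (suppProj ρ - 1))ᴴ * (sqrtM ρ * (suppProj ρ - 1))) = 0 := by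
    rw [conjTranspose_mul, conjTranspose_sub, hP.eq, conjTranspose_one,
      (sqrtM_posSemidef ρ).1.eq, mul_assoc, ← mul_assoc (sqrtM ρ), sqrtM_mul_self hρ, ← mul_assoc,
      h, zero_mul]
  have e1 := conjTranspose_mul_self_eq_zero.1 e
  rwa [mul_sub, mul_one, sub_eq_zero] at e1

/-- Off the range of P, e^{G/2} is the identity while √σ is zero; √ρ does not see the difference. -/
theorem trace_sqrtM_mul_sqrtM_expLogSum (hρ : ρ.PosSemidef) :
    (sqrtM ρ * sqrtM (expLogSum ρ)).trace =
      (sqrtM ρ * cfc (fun x : ℝ => Real.exp (x / 2))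
        (suppProj ρ * logSum ρ * suppProj ρ)).trace := by
  have hP : (suppProj ρ).IsHermitian := isHermitian_commonSupport _ _
  have h1 := sqrtM_mul_suppProj hρ
  have h2 : suppProj ρ * sqrtM ρ = sqrtM ρ := by
    simpa [hP.eq, (sqrtM_posSemidef ρ).1.eq] using congrArg conjTranspose h1
  have e : sqrtM (expLogSum ρ) = suppProj ρ * cfc (fun x : ℝ => Real.exp (x / 2))
      (suppProj ρ * logSum ρ * suppProj ρ) * suppProj ρ := sqrtM_mul_exp_mul hP (commonSupport_mul_self _ _)
    (isHermitian_suppProj_mul_logSum_mul ρ) (suppProj_mul_compression ρ)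
  rw [e, ← mul_assoc, ← mul_assoc, h1, Matrix.trace_mul_cycle, h2]

theorem trace_mul_compression (hρ : ρ.PosSemidef) :
    (ρ * (suppProj ρ * logSum ρ * suppProj ρ)).trace.re
      = -entropy (margAB ρ) - entropy (margBC ρ) := by
  have hP : (suppProj ρ).IsHermitian := isHermitian_commonSupport _ _
  have h1 := suppProj_mul hρ
  have h2 : ρ * suppProj ρ = ρ := mul_eq_self_of_mul_eq_self hP hρ.1 h1
  rw [← mul_assoc, ← mul_assoc, h2, Matrix.trace_mul_cycle, h1, logSum, mul_add, trace_add,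
    trace_mul_tensorIdC, trace_mul_idTensorA, entropy, entropy, Complex.add_re]
  ring

end Tripartite

theorem mainTheorem11 {a b c : Type*} [Fintype a] [DecidableEq a] [Fintype b] [DecidableEq b]
    [Fintype c] [DecidableEq c] (ρ : Matrix (a × b × c) (a × b × c) ℂ)
    (hρ : Tripartite.IsState ρ) :
    (Tripartite.expLogSum ρ).PosSemidef ∧
    (Tripartite.expLogSum ρ).trace.re ≤ 1 ∧
    0 < (Tripartite.sqrtM ρ * Tripartite.sqrtM (Tripartite.expLogSum ρ)).trace.re ∧
    -2 * Real.log (Tripartite.sqrtM ρ * Tripartite.sqrtM (Tripartite.expLogSum ρ)).trace.re ≤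
      Tripartite.entropy (Tripartite.margAB ρ) + Tripartite.entropy (Tripartite.margBC ρ)
        - Tripartite.entropy ρ ∧
    Tripartite.hsNorm (Tripartite.sqrtM ρ - Tripartite.sqrtM (Tripartite.expLogSum ρ)) ^ 2 ≤
      -2 * Real.log
        (Tripartite.sqrtM ρ * Tripartite.sqrtM (Tripartite.expLogSum ρ)).trace.re ∧
    (1 / 4 : ℝ) * Tripartite.traceNorm (ρ - Tripartite.expLogSum ρ) ^ 2 ≤
      Tripartite.hsNorm
        (Tripartite.sqrtM ρ - Tripartite.sqrtM (Tripartite.expLogSum ρ)) ^ 2 := by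
  have hG := Tripartite.isHermitian_suppProj_mul_logSum_mul ρ
  have hσ : (Tripartite.expLogSum ρ).PosSemidef :=
    Tripartite.posSemidef_mul_exp_mul (Tripartite.isHermitian_commonSupport _ _) hG
  have hσ1 := Tripartite.trace_expLogSum_le hρ
  have hρ1 : ρ.trace.re = 1 := by rw [hρ.2, Complex.one_re]
  obtain ⟨hpos, hle⟩ := Tripartite.relEntropy_ge hρ hG
  rw [← Tripartite.trace_sqrtM_mul_sqrtM_expLogSum hρ.1] at hpos hle
  rw [Tripartite.trace_mul_compression hρ.1] at hle
  refine ⟨hσ, hσ1, hpos, ?_, ?_, Tripartite.traceNorm_sub_sq_le hρ.1 hσ hρ1.le hσ1⟩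
  · refine hle.trans_eq ?_
    rw [Tripartite.entropy.eq_1 ρ]
    ring
  -- With t = Tr √ρ√σ: 1 + Tr σ - 2t ≤ 2(1 - t) ≤ -2 log t.
  · rw [Tripartite.hsNorm_sqrtM_sub_sq hρ.1 hσ, hρ1]
    have := Real.log_le_sub_one_of_pos hpos
    linarith
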